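/- Let $X$ be a finite abstract simplicial complex with exactly $n\ge 2$ vertices, let $G_X$ be its $1$-skeleton, i.e. the graph whose vertices and edges are the $0$- and $1$-dimensional simplices of $X$, and assume that $G_X$ is connected. Let $\lambda_2(G_X)$ be the second smallest eigenvalue, counted with multiplicity, of the unnormalized Laplacian $L(G_X)$ (vertex degrees on the diagonal, $-1$ for adjacent pairs of vertices, $0$ elsewhere). For a simplex $\sigma\in X$ let $\mathrm{lk}_X(\sigma)=\{\eta\in X : \sigma\cup\eta\in X,\ \sigma\cap\eta=\emptyset\}$. For $k\ge 1$ let $$D_k(X,k+1)=\max_{\sigma}\ \bigl|\{u : u\notin \mathrm{lk}_X(\sigma)\ \text{and}\ u\in\mathrm{lk}_X(\sigma\setminus\{v\})\ \text{for exactly } k+1 \text{ vertices } v\in\sigma\}\bigr|,$$ where $\sigma$ runs over the $k$-dimensional simplices of $X$ and $u$ over the vertices of $X$ (the maximum is $0$ if $X$ has no $k$-dimensional simplex). Let $k\ge 1$ and suppose that the $k$-skeleton of $X$ equals the $k$-skeleton of the clique complex of $G_X$, the complex of all vertex sets that span a complete subgraph of $G_X$. If $$\lambda_2(G_X) > \frac{kn}{k+1}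 + (k+1)\,D_k(X,k+1),$$ then $\widetilde H^k(X)=\ker\delta_k/\operatorname{im}\delta_{k-1}$, the $k$-th reduced simplicial cohomology of $X$ with real coefficients, vanishes. -/

import Mathlib

/-!
Finite simplicial complexes are modelled by Mathlib's `AbstractSimplicialComplex V` with `V` finite:
a family of nonempty subsets of `V`, closed under passing to nonempty subsets, that contains every
singleton, so that `V` is exactly the vertex set. A `k`-simplex is a face with `k + 1` elements.
-/

namespace AbstractSimplicialComplex

variable {V : Type*}

open scoped Classical in
/-- The `1`-skeleton `G_X` of `X` as a graph: vertices are the `0`-simplices and edges are the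
`1`-simplices of `X`. -/
def oneSkeleton (X : AbstractSimplicialComplex V) : SimpleGraph V where
  Adj u v := u ≠ v ∧ ({u, v} : Finset V) ∈ X.faces
  symm := ⟨fun u v h => ⟨h.1.symm, by rw [Finset.pair_comm]; exact h.2⟩⟩
  loopless := ⟨fun _ h => h.1 rfl⟩

/-- The clique complex of a graph: its simplices are the nonempty finite vertex sets that span a
complete subgraph. -/
def cliqueComplex (G : SimpleGraph V) : AbstractSimplicialComplex V where
  faces := {σ | σ.Nonempty ∧ G.IsClique (σ : Set V)}
  isRelLowerSet_faces := fun _ h =>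
    ⟨h.1, fun _ hts ht => ⟨ht, Set.Pairwise.mono (Finset.coe_subset.mpr hts) h.2⟩⟩
  singleton_mem v := ⟨Finset.singleton_nonempty v, by simp⟩

/-- The `k`-skeleton of `X`: the subcomplex of all simplices of dimension at most `k`. -/
def skeleton (X : AbstractSimplicialComplex V) (k : ℕ) : AbstractSimplicialComplex V where
  faces := {σ | σ ∈ X.faces ∧ σ.card ≤ k + 1}
  isRelLowerSet_faces := fun _ h =>
    ⟨(X.isRelLowerSet_faces h.1).1, fun _ hts ht =>
      ⟨(X.isRelLowerSet_faces h.1).2 hts ht, (Finset.card_le_card hts).trans h.2⟩⟩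
  singleton_mem v := ⟨X.singleton_mem v, by simp⟩

open scoped Classical in
/-- The link of `σ` in `X`: the complex of all `η ∈ X` with `σ ∪ η ∈ X` and `σ ∩ η = ∅`. -/
def link (X : AbstractSimplicialComplex V) (σ : Finset V) : PreAbstractSimplicialComplex V where
  faces := {η | η ∈ X.faces ∧ σ ∪ η ∈ X.faces ∧ σ ∩ η = ∅}
  isRelLowerSet_faces := fun _ h =>
    ⟨(X.isRelLowerSet_faces h.1).1, fun _ hts ht =>
      ⟨(X.isRelLowerSet_faces h.1).2 hts ht,
        (X.isRelLowerSet_faces h.2.1).2 (Finset.union_subset_union_right hts)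
          (ht.mono Finset.subset_union_right),
        Finset.subset_empty.mp (h.2.2 ▸ Finset.inter_subset_inter_left hts)⟩⟩

open scoped Classical in
/-- The finite set of (unoriented) `k`-simplices of `X`. -/
noncomputable def simplices [Fintype V] (X : AbstractSimplicialComplex V) (k : ℕ) :
    Finset (Finset V) :=
  {σ | σ ∈ X.faces ∧ σ.card = k + 1}

open scoped Classical in
/-- `D_k(X, j)`: the maximum over all `k`-simplices `σ` of the number of vertices `u` that are not in
`lk_X(σ)` and for which there are exactly `j` vertices `v ∈ σ` with `u ∈ lk_X(σ \ {v})`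
(and `0` if `X` has no `k`-simplex). -/
noncomputable def cliqueDefect [Fintype V] (X : AbstractSimplicialComplex V) (k j : ℕ) : ℕ :=
  (X.simplices k).sup fun σ =>
    Finset.card {u : V | {u} ∉ (X.link σ).faces ∧
      Finset.card {v ∈ σ | {u} ∈ (X.link (σ \ {v})).faces} = j}

/-- An ordered `k`-simplex of `X`: an enumeration `(v₀, …, v_k)` without repetitions of the vertices
of a `k`-simplex. -/
def OrderedSimplex (X : AbstractSimplicialComplex V) (k : ℕ) : Type _ :=
  {s : Fin (k + 1) ↪ V // Finset.univ.map s ∈ X.faces}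

namespace OrderedSimplex

variable {X : AbstractSimplicialComplex V} {k : ℕ}

/-- The reordering `(v_{π 0}, …, v_{π k})` of an ordered simplex `(v₀, …, v_k)`. -/
def reorder (s : X.OrderedSimplex k) (π : Equiv.Perm (Fin (k + 1))) : X.OrderedSimplex k :=
  ⟨π.toEmbedding.trans s.1, by
    rw [← Finset.map_map, Finset.map_univ_equiv]; exact s.2⟩

/-- The `j`-th face `(v₀, …, v̂_j, …, v_{k+1})` of an ordered simplex `(v₀, …, v_{k+1})`. -/
def face (s : X.OrderedSimplex (k + 1)) (j : Fin (k + 2)) : X.OrderedSimplex k :=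
  ⟨(Fin.succAboveEmb j).trans s.1, by
    refine (X.isRelLowerSet_faces s.2).2 ?_ (Finset.univ_nonempty.map)
    rw [← Finset.map_map]
    exact Finset.map_subset_map.mpr (Finset.subset_univ _)⟩

end OrderedSimplex

/-- The real `k`-cochains of `X`, `k ≥ 0`, as a space of functions on ordered `k`-simplices. A homomorphism to `ℝ` from the group
generated by the oriented `k`-simplices, subject to the relation that reversing the orientation
changes the sign, is the same as a function on ordered `k`-simplices that is multiplied by the sign
of the permutation when the vertices are reordered. -/
def cochainSubmodule (X : AbstractSimplicialComplex V) (k : ℕ) : Submodule ℝ (X.OrderedSimplex k → ℝ) where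
  carrier := {φ | ∀ s π, φ (s.reorder π) = ((Equiv.Perm.sign π : ℤ) : ℝ) * φ s}
  zero_mem' := by intro s π; simp
  add_mem' := by intro a b ha hb s π; simp [ha s π, hb s π, mul_add]
  smul_mem' := by intro c a ha s π; simp [ha s π]; ring

/-- The space `C^k(X; ℝ)` of real `k`-cochains of `X`, `k ≥ 0`. -/
def Cochain (X : AbstractSimplicialComplex V) (k : ℕ) : Type _ :=
  X.cochainSubmodule k

instance (X : AbstractSimplicialComplex V) (k : ℕ) : AddCommGroup (X.Cochain k) :=
  inferInstanceAs (AddCommGroup (X.cochainSubmodule k))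

instance (X : AbstractSimplicialComplex V) (k : ℕ) : Module ℝ (X.Cochain k) :=
  inferInstanceAs (Module ℝ (X.cochainSubmodule k))

/-- Deleting the `j`-th vertex after reordering by `π` amounts to deleting the `π j`-th vertex and
then reordering by a permutation of sign `(-1) ^ (j + π j) * sign π`. -/
theorem OrderedSimplex.exists_face_reorder {X : AbstractSimplicialComplex V} {k : ℕ}
    (s : X.OrderedSimplex (k + 1)) (π : Equiv.Perm (Fin (k + 2))) (j : Fin (k + 2)) :
    ∃ ρ : Equiv.Perm (Fin (k + 1)), (s.reorder π).face j = (s.face (π j)).reorder ρ ∧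
      Equiv.Perm.sign π = (-1) ^ (j : ℕ) * (-1) ^ ((π j : Fin (k + 2)) : ℕ) *
        Equiv.Perm.sign ρ := by
  set τ : Equiv.Perm (Fin (k + 2)) := (π j).cycleRange * π * j.cycleRange⁻¹ with hτ
  obtain ⟨⟨p, ρ⟩, hρ⟩ := Equiv.Perm.decomposeFin.symm.surjective τ
  have h0 : τ 0 = 0 := by
    simp [hτ]
  have hp : p = 0 := by
    rw [← hρ, Equiv.Perm.decomposeFin_symm_apply_zero] at h0; exact h0
  subst hp
  have hs : ∀ x, τ x.succ = (ρ x).succ := by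
    intro x; rw [← hρ, Equiv.Perm.decomposeFin_symm_apply_succ]; simp
  refine ⟨ρ, ?_, ?_⟩
  · apply Subtype.ext
    ext x
    change s.1 (π (j.succAbove x)) = s.1 ((π j).succAbove (ρ x))
    congr 1
    apply (π j).cycleRange.injective
    rw [Fin.cycleRange_succAbove, ← hs x]
    simp [hτ]
  · have h1 : Equiv.Perm.sign τ = Equiv.Perm.sign ρ := by
      rw [← hρ, Equiv.Perm.decomposeFin.symm_sign]; simp
    rw [← h1, hτ, map_mul, map_mul, Equiv.Perm.sign_inv, Fin.sign_cycleRange, Fin.sign_cycleRange]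
    have ha : ((-1 : ℤˣ) ^ (j : ℕ)) * (-1) ^ (j : ℕ) = 1 := Int.units_mul_self _
    have hb : ((-1 : ℤˣ) ^ ((π j : Fin (k + 2)) : ℕ)) * (-1) ^ ((π j : Fin (k + 2)) : ℕ) = 1 :=
      Int.units_mul_self _
    calc Equiv.Perm.sign π = (((-1 : ℤˣ) ^ (j : ℕ)) * (-1) ^ (j : ℕ)) *
          (((-1 : ℤˣ) ^ ((π j : Fin (k + 2)) : ℕ)) * (-1) ^ ((π j : Fin (k + 2)) : ℕ)) *
            Equiv.Perm.sign π := by rw [ha, hb]; simp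
      _ = _ := by
        simp only [mul_comm, mul_left_comm, mul_assoc]

/-- The coboundary operator `δ_k : C^k(X; ℝ) → C^{k+1}(X; ℝ)` for `k ≥ 0`,
`(δ_k φ)(σ) = ∑_j (-1)^j φ(σ_j)`, where `σ_j` is the `j`-th face of `σ`. -/
def coboundary (X : AbstractSimplicialComplex V) (k : ℕ) :
    X.Cochain k →ₗ[ℝ] X.Cochain (k + 1) where
  toFun φ := ⟨fun s => ∑ j : Fin (k + 2), (-1) ^ (j : ℕ) * φ.1 (s.face j), by
    intro s π
    change ∑ j : Fin (k + 2), (-1) ^ (j : ℕ) * φ.1 ((s.reorder π).face j) =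
      _ * ∑ j : Fin (k + 2), (-1) ^ (j : ℕ) * φ.1 (s.face j)
    rw [← Equiv.sum_comp π (fun j => (-1) ^ (j : ℕ) * φ.1 (s.face j)), Finset.mul_sum]
    refine Finset.sum_congr rfl fun j _ => ?_
    obtain ⟨ρ, h1, h2⟩ := s.exists_face_reorder π j
    rw [h1, φ.2 (s.face (π j)) ρ, h2]
    push_cast
    have hb : ((-1 : ℝ) ^ ((π j : Fin (k + 2)) : ℕ)) * (-1) ^ ((π j : Fin (k + 2)) : ℕ) = 1 := by
      rw [← mul_pow]; simp
    linear_combination (-((-1 : ℝ) ^ (j : ℕ) * ((Equiv.Perm.sign ρ : ℤ) : ℝ) *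
      φ.1 (s.face (π j)))) * hb⟩
  map_add' φ ψ := by
    apply Subtype.ext; funext s
    change ∑ j : Fin (k + 2), (-1) ^ (j : ℕ) * (φ.1 (s.face j) + ψ.1 (s.face j)) =
      ∑ j : Fin (k + 2), (-1) ^ (j : ℕ) * φ.1 (s.face j) +
        ∑ j : Fin (k + 2), (-1) ^ (j : ℕ) * ψ.1 (s.face j)
    simp only [mul_add, Finset.sum_add_distrib]
  map_smul' c φ := by
    apply Subtype.ext; funext s
    change ∑ j : Fin (k + 2), (-1) ^ (j : ℕ) * (c * φ.1 (s.face j)) =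
      c * ∑ j : Fin (k + 2), (-1) ^ (j : ℕ) * φ.1 (s.face j)
    rw [Finset.mul_sum]
    exact Finset.sum_congr rfl fun j _ => by ring

/-- The augmentation `δ_{-1} : C^{-1}(X; ℝ) = ℝ → C^0(X; ℝ)`, `δ_{-1}(x)(v) = x`. -/
def augmentation (X : AbstractSimplicialComplex V) : ℝ →ₗ[ℝ] X.Cochain 0 where
  toFun x := ⟨fun _ => x, by
    intro s π
    have : π = 1 := Equiv.ext fun i => Subsingleton.elim (α := Fin 1) _ _
    simp [this]⟩
  map_add' _ _ := rfl
  map_smul' _ _ := rfl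

/-- The reduced `k`-coboundaries: the image of `δ_{k-1}`. -/
def coboundaries (X : AbstractSimplicialComplex V) : (k : ℕ) → Submodule ℝ (X.Cochain k)
  | 0 => LinearMap.range X.augmentation
  | k + 1 => LinearMap.range (X.coboundary k)

/-- The `k`-th reduced cohomology `H̃^k(X) = ker δ_k / im δ_{k-1}` with real coefficients. -/
abbrev ReducedCohomology (X : AbstractSimplicialComplex V) (k : ℕ) : Type _ :=
  LinearMap.ker (X.coboundary k) ⧸
    (X.coboundaries k).submoduleOf (LinearMap.ker (X.coboundary k))

end AbstractSimplicialComplex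

open scoped Classical in
/-- The spectral gap `λ₂(G)`: the second smallest eigenvalue, counted with multiplicity, of the
(unnormalized) Laplacian matrix of `G`. Mathlib lists the eigenvalues in decreasing order, with
indices `0, …, |V| - 1`, so it is the one with index `|V| - 2`. A graph with fewer than two vertices
has no second eigenvalue and gets the value `0`. -/
noncomputable def SimpleGraph.spectralGap {V : Type*} [Fintype V] (G : SimpleGraph V) : ℝ :=
  if h : 2 ≤ Fintype.card V then
    (G.isHermitian_lapMatrix (R := ℝ)).eigenvalues₀ ⟨Fintype.card V - 2, by omega⟩
  else 0

/-!
The proof is Hodge theory together with a weighted count in the style of Aharoni, Berger and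
Meshulam. By orthogonal projection (`Cochain.exists_sub_coboundary_orthogonal`) every cocycle is
cohomologous to one, `φ`, orthogonal to all coboundaries, and it suffices to show `φ = 0`.
Extend `φ` by zero to an alternating function `f` on all tuples of `k + 1` vertices. Orthogonality
says `∑_v f(v, t) = 0` for every `k`-tuple `t`, since this sum is the adjoint coboundary
(`Cochain.sum_zeroExtend_cons_eq_zero`). So each function `v ↦ f(v, t)` satisfies the variational
inequality for `λ₂` (`SimpleGraph.spectralGap_mul_sum_sq_le`), and summing over `t` gives
`2 λ₂ ‖f‖² ≤ ∑_t ∑_{u ∼ v} (f(u, t) - f(v, t))²`, the inner sum being over ordered pairs.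

The right-hand side splits according to whether `(u, v, t)` is a clique. If it is not, one of the
two values is `0`. If it is, the difference is, up to sign, the sum of two of the `k + 2` signed
face terms `a_j` of `(u, v, t)`, and averaging over all pairs of faces replaces the squares by
`∑ a_j²` and `(∑ a_j)²` (`TupleCochain.sum_faceTerm_zero_add_one_sq`). The term `(∑ a_j)²` vanishes
on simplices of `X`, where it is the squared coboundary of `φ`; on cliques missing from `X` it is at
most `(k + 2) ∑ a_j²`, and every `k`-simplex lies in at most `D = D_k(X, k + 1)` of these. Counting
how often each `f(s)²` occurs (`TupleCochain.clique_or_adj_le`) yields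
`(k + 1) λ₂ ‖f‖² ≤ (k n + (k + 2) D) ‖f‖²` (`TupleCochain.gap_mul_sum_sq_le`). As
`k + 2 ≤ (k + 1)²` for `k ≥ 1`, the hypothesis on `λ₂` forces `f = 0`.
-/

/-! ### The variational inequality for the spectral gap -/

open scoped Classical in
/-- The Laplacian quadratic form is at least `λ₂` on functions with sum zero. In an orthonormal
eigenbasis all vectors but one have eigenvalue at least `λ₂ > 0`, hence are orthogonal to the
constants, which lie in the kernel; so the remaining vector spans the constants. -/
theorem SimpleGraph.spectralGap_mul_sum_sq_le {V : Type*} [Fintype V] (G : SimpleGraph V)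
    (hpos : 0 < G.spectralGap) (x : V → ℝ) (hx : ∑ v, x v = 0) :
    G.spectralGap * ∑ v, x v ^ 2 ≤
      (∑ u, ∑ v, if G.Adj u v then (x u - x v) ^ 2 else 0) / 2 := by
  have hcard : 2 ≤ Fintype.card V := by
    by_contra h
    simp [SimpleGraph.spectralGap, h] at hpos
  have hgap : G.spectralGap = (G.isHermitian_lapMatrix (R := ℝ)).eigenvalues₀
      ⟨Fintype.card V - 2, by omega⟩ := by
    simp [SimpleGraph.spectralGap, hcard]
  set hL := G.isHermitian_lapMatrix (R := ℝ)
  set b := hL.eigenvectorBasis with hb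
  set y : EuclideanSpace ℝ V := WithLp.toLp 2 x with hy
  set one : EuclideanSpace ℝ V := WithLp.toLp 2 (fun _ => 1) with hone
  obtain ⟨l, hl⟩ : ∃ l : V, ∀ i, i ≠ l → G.spectralGap ≤ hL.eigenvalues i := by
    set e := (Fintype.equivOfCardEq (Fintype.card_fin _) : Fin (Fintype.card V) ≃ V) with he
    refine ⟨e ⟨Fintype.card V - 1, by omega⟩, fun i hi => ?_⟩
    rw [hgap, Matrix.IsHermitian.eigenvalues]
    apply hL.eigenvalues₀_antitone
    have : e.symm i ≠ ⟨Fintype.card V - 1, by omega⟩ := fun h => hi (by rw [← h]; simp)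
    have h2 := (e.symm i).2
    rw [Fin.le_def]
    have h3 : (e.symm i : ℕ) ≠ Fintype.card V - 1 := fun h => this (Fin.ext h)
    change (e.symm i : ℕ) ≤ Fintype.card V - 2
    omega
  -- the inner product of an eigenvector with the image of a vector under the Laplacian
  have hin : ∀ (i : V) (z : V → ℝ),
      inner ℝ (b i) (WithLp.toLp 2 ((G.lapMatrix ℝ).mulVec z) : EuclideanSpace ℝ V) =
        hL.eigenvalues i * inner ℝ (b i) (WithLp.toLp 2 z : EuclideanSpace ℝ V) := by
    intro i z
    have h1 := hL.mulVec_eigenvectorBasis i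
    have h2 : ((G.lapMatrix ℝ).mulVec z) ⬝ᵥ (b i).ofLp = z ⬝ᵥ (G.lapMatrix ℝ).mulVec (b i).ofLp := by
      rw [Matrix.dotProduct_mulVec, ← Matrix.mulVec_transpose, (G.isSymm_lapMatrix (R := ℝ)).eq]
    rw [EuclideanSpace.inner_eq_star_dotProduct, EuclideanSpace.inner_eq_star_dotProduct]
    simp only [star_trivial]
    rw [h2, h1, dotProduct_smul, smul_eq_mul]
  have hone0 : ∀ i, i ≠ l → inner ℝ (b i) one = 0 := by
    intro i hi
    have h := hin i (fun _ => 1)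
    rw [G.lapMatrix_mulVec_const_eq_zero] at h
    have h' : 0 = hL.eigenvalues i * inner ℝ (b i) one := by
      rw [← h]; exact (inner_zero_right _).symm
    rcases mul_eq_zero.mp h'.symm with h0 | h0
    · have := hl i hi; linarith
    · exact h0
  have hone1 : one = (inner ℝ (b l) one : ℝ) • b l := by
    conv_lhs => rw [← b.sum_repr' one]
    refine Finset.sum_eq_single l (fun i _ hi => by rw [hone0 i hi, zero_smul]) (by simp)
  -- since `1` is a nonzero multiple of `b l`, a vector orthogonal to `1` is orthogonal to `b l`
  have hly : inner ℝ (b l) y = 0 := by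
    have h0 : inner ℝ one y = 0 := by
      rw [EuclideanSpace.inner_eq_star_dotProduct]
      simp [hone, hy, dotProduct, hx]
    rw [hone1, real_inner_smul_left] at h0
    rcases mul_eq_zero.mp h0 with h | h
    · rw [h, zero_smul] at hone1
      have : Nonempty V := ⟨l⟩
      have := congrArg (fun z : EuclideanSpace ℝ V => z l) hone1
      simp [hone] at this
    · exact h
  have hq : (∑ u, ∑ v, if G.Adj u v then (x u - x v) ^ 2 else 0) / 2 =
      ∑ i, hL.eigenvalues i * inner ℝ (b i) y ^ 2 := by
    rw [← G.lapMatrix_toLinearMap₂' (R := ℝ), Matrix.toLinearMap₂'_apply']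
    have h1 : x ⬝ᵥ (G.lapMatrix ℝ).mulVec x =
        inner ℝ y (WithLp.toLp 2 ((G.lapMatrix ℝ).mulVec x) : EuclideanSpace ℝ V) := by
      rw [EuclideanSpace.inner_eq_star_dotProduct]
      simp [hy, dotProduct_comm]
    rw [h1, ← b.sum_inner_mul_inner]
    refine Finset.sum_congr rfl fun i _ => ?_
    rw [hin, real_inner_comm, ← hy]; ring
  have hn : ∑ v, x v ^ 2 = ∑ i, inner ℝ (b i) y ^ 2 := by
    have := b.sum_inner_mul_inner y y
    rw [EuclideanSpace.inner_eq_star_dotProduct] at this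
    simp only [hy, star_trivial, dotProduct] at this
    simp only [pow_two, ← this, hy]
    exact Finset.sum_congr rfl fun i _ => by rw [real_inner_comm]
  rw [hq, hn, Finset.mul_sum]
  refine Finset.sum_le_sum fun i _ => ?_
  by_cases hi : i = l
  · rw [hi, hly]; simp
  · exact mul_le_mul_of_nonneg_right (hl i hi) (sq_nonneg _)

/-! ### Alternating functions on tuples -/

namespace TupleCochain

variable {V : Type*}

/-- The tuple `r` enumerates without repetition the vertices of a clique of `G`. -/
def IsCliqueTuple (G : SimpleGraph V) {m : ℕ} (r : Fin m → V) : Prop :=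
  ∀ i j, i ≠ j → G.Adj (r i) (r j)

/-- A function on ordered tuples is alternating if reordering the entries multiplies it by the sign
of the permutation. -/
def IsAlternating {m : ℕ} (f : (Fin m → V) → ℝ) : Prop :=
  ∀ s (π : Equiv.Perm (Fin m)), f (s ∘ π) = ((Equiv.Perm.sign π : ℤ) : ℝ) * f s

/-- The `j`-th signed term `(-1)^j f(r₀, …, r̂_j, …)` of the coboundary of `f` at `r`. -/
def faceTerm {m : ℕ} (f : (Fin m → V) → ℝ) (r : Fin (m + 1) → V) (j : Fin (m + 1)) : ℝ :=
  (-1) ^ (j : ℕ) * f (r ∘ j.succAbove)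

theorem isCliqueTuple_comp_perm {G : SimpleGraph V} {m : ℕ} (r : Fin m → V)
    (π : Equiv.Perm (Fin m)) : IsCliqueTuple G (r ∘ π) ↔ IsCliqueTuple G r := by
  constructor
  · intro h i j hij
    simpa using h (π.symm i) (π.symm j) (fun e => hij (π.symm.injective e))
  · intro h i j hij
    exact h _ _ (fun e => hij (π.injective e))

theorem isCliqueTuple_cons {G : SimpleGraph V} {m : ℕ} (u : V) (t : Fin m → V) :
    IsCliqueTuple G (Fin.cons u t : Fin (m + 1) → V) ↔
      (∀ i, G.Adj u (t i)) ∧ IsCliqueTuple G t := by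
  constructor
  · intro h
    refine ⟨fun i => by simpa using h 0 i.succ (Fin.succ_ne_zero i).symm, fun i j hij => ?_⟩
    simpa using h i.succ j.succ (fun e => hij (Fin.succ_injective _ e))
  · rintro ⟨h1, h2⟩ i j hij
    induction i using Fin.cases with
    | zero =>
      induction j using Fin.cases with
      | zero => exact absurd rfl hij
      | succ j => simpa using h1 j
    | succ i =>
      induction j using Fin.cases with
      | zero => simpa using (h1 i).symm
      | succ j => simpa using h2 i j (fun e => hij (by rw [e]))

theorem isCliqueTuple_cons_cons_comm {G : SimpleGraph V} {m : ℕ} (u v : V) (t : Fin m → V) :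
    IsCliqueTuple G (Fin.cons u (Fin.cons v t : Fin (m + 1) → V) : Fin (m + 2) → V) ↔
      IsCliqueTuple G (Fin.cons v (Fin.cons u t : Fin (m + 1) → V) : Fin (m + 2) → V) := by
  simp only [isCliqueTuple_cons, Fin.forall_fin_succ, Fin.cons_zero, Fin.cons_succ, G.adj_comm u v]
  tauto

theorem sum_cons [Fintype V] {m : ℕ} (F : (Fin (m + 1) → V) → ℝ) :
    ∑ r, F r = ∑ v, ∑ t : Fin m → V, F (Fin.cons v t) := by
  rw [← Fintype.sum_prod_type']
  exact ((Fin.consEquiv fun _ => V).sum_comp F).symm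

theorem sum_comp_perm [Fintype V] {m : ℕ} (F : (Fin m → V) → ℝ) (π : Equiv.Perm (Fin m)) :
    ∑ r : Fin m → V, F (r ∘ π) = ∑ r, F r :=
  (π.symm.arrowCongr (Equiv.refl V)).sum_comp F

/-- Deleting an entry after a permutation is, up to a permutation, deleting the permuted entry; this
is `OrderedSimplex.exists_face_reorder` for the identity simplex of the full simplex. -/
theorem exists_comp_succAbove {k : ℕ} (π : Equiv.Perm (Fin (k + 2))) (j : Fin (k + 2)) :
    ∃ ρ : Equiv.Perm (Fin (k + 1)), π ∘ j.succAbove = (π j).succAbove ∘ ρ ∧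
      Equiv.Perm.sign π = (-1) ^ (j : ℕ) * (-1) ^ ((π j : Fin (k + 2)) : ℕ) *
        Equiv.Perm.sign ρ := by
  let X := AbstractSimplicialComplex.cliqueComplex (⊤ : SimpleGraph (Fin (k + 2)))
  let s : X.OrderedSimplex (k + 1) := ⟨Function.Embedding.refl _,
    Finset.univ_nonempty.map, fun _ _ _ _ h => h⟩
  obtain ⟨ρ, h1, h2⟩ := s.exists_face_reorder π j
  exact ⟨ρ, congrArg (fun t : X.OrderedSimplex k => (t.1 : Fin (k + 1) → Fin (k + 2))) h1, h2⟩

theorem IsAlternating.faceTerm_comp_perm {k : ℕ} {f : (Fin (k + 1) → V) → ℝ}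
    (hf : IsAlternating f) (r : Fin (k + 2) → V) (π : Equiv.Perm (Fin (k + 2)))
    (j : Fin (k + 2)) :
    faceTerm f (r ∘ π) j = ((Equiv.Perm.sign π : ℤ) : ℝ) * faceTerm f r (π j) := by
  obtain ⟨ρ, h1, h2⟩ := exists_comp_succAbove π j
  rw [faceTerm, faceTerm, Function.comp_assoc, h1, ← Function.comp_assoc, hf, h2]
  push_cast
  have hb : ((-1 : ℝ) ^ ((π j : Fin (k + 2)) : ℕ)) * (-1) ^ ((π j : Fin (k + 2)) : ℕ) = 1 := by
    rw [← mul_pow]; simp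
  linear_combination (-((-1 : ℝ) ^ (j : ℕ) * ((Equiv.Perm.sign ρ : ℤ) : ℝ) *
      f (r ∘ (π j).succAbove))) * hb

theorem sign_sq {m : ℕ} (π : Equiv.Perm (Fin m)) : ((Equiv.Perm.sign π : ℤ) : ℝ) ^ 2 = 1 := by
  rcases Int.units_eq_one_or (Equiv.Perm.sign π) with h | h <;> rw [h] <;> norm_num

theorem IsAlternating.sq_comp_perm {m : ℕ} {f : (Fin m → V) → ℝ} (hf : IsAlternating f)
    (s : Fin m → V) (π : Equiv.Perm (Fin m)) : f (s ∘ π) ^ 2 = f s ^ 2 := by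
  rw [hf, mul_pow, sign_sq, one_mul]

/-! ### Averaging over faces -/

/-- Summed over a permutation-invariant set of tuples, all squared face terms contribute equally. -/
theorem sum_faceTerm_sq_eq [Fintype V] {k : ℕ} {f : (Fin (k + 1) → V) → ℝ}
    (hf : IsAlternating f) (Q : (Fin (k + 2) → V) → Prop) [DecidablePred Q]
    (hQ : ∀ r (π : Equiv.Perm (Fin (k + 2))), Q (r ∘ π) ↔ Q r) (j : Fin (k + 2)) :
    ∑ r, (if Q r then faceTerm f r j ^ 2 else 0) = ∑ r, if Q r then faceTerm f r 0 ^ 2 else 0 := by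
  rw [← sum_comp_perm (fun r => if Q r then faceTerm f r 0 ^ 2 else 0) (Equiv.swap 0 j)]
  refine Finset.sum_congr rfl fun r _ => ?_
  simp only [hQ, hf.faceTerm_comp_perm, mul_pow, sign_sq, one_mul, Equiv.swap_apply_left]

/-- Summed over a permutation-invariant set of tuples, all squared sums of two distinct face terms
contribute equally. -/
theorem sum_faceTerm_add_sq_eq [Fintype V] {k : ℕ} {f : (Fin (k + 1) → V) → ℝ}
    (hf : IsAlternating f) (Q : (Fin (k + 2) → V) → Prop) [DecidablePred Q]
    (hQ : ∀ r (π : Equiv.Perm (Fin (k + 2))), Q (r ∘ π) ↔ Q r) {i j : Fin (k + 2)} (hij : i ≠ j) :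
    ∑ r, (if Q r then (faceTerm f r i + faceTerm f r j) ^ 2 else 0) =
      ∑ r, if Q r then (faceTerm f r 0 + faceTerm f r 1) ^ 2 else 0 := by
  obtain ⟨π, h0, h1⟩ : ∃ π : Equiv.Perm (Fin (k + 2)), π 0 = i ∧ π 1 = j := by
    refine ⟨Equiv.swap (Equiv.swap 0 i 1) j * Equiv.swap 0 i, ?_, ?_⟩
    · rw [Equiv.Perm.mul_apply, Equiv.swap_apply_left]
      refine Equiv.swap_apply_of_ne_of_ne ?_ hij
      intro h
      have : Equiv.swap 0 i 0 = Equiv.swap 0 i 1 := by rw [Equiv.swap_apply_left]; exact h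
      exact absurd ((Equiv.swap 0 i).injective this) (by simp)
    · rw [Equiv.Perm.mul_apply, Equiv.swap_apply_left]
  rw [← sum_comp_perm (fun r => if Q r then (faceTerm f r 0 + faceTerm f r 1) ^ 2 else 0) π]
  refine Finset.sum_congr rfl fun r _ => ?_
  simp only [hQ, hf.faceTerm_comp_perm, h0, h1, ← mul_add, mul_pow, sign_sq, one_mul]

/-- The identity `∑_{i ≠ j} (a_i + a_j)² = 2 (m - 2) ∑ a_i² + 2 (∑ a_i)²`. -/
theorem sum_add_sq_offDiag {m : ℕ} (a : Fin m → ℝ) :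
    ∑ i, ∑ j, (if i = j then 0 else (a i + a j) ^ 2) =
      2 * ((m : ℝ) - 2) * ∑ i, a i ^ 2 + 2 * (∑ i, a i) ^ 2 := by
  have h1 : ∀ i, ∑ j, (if i = j then 0 else (a i + a j) ^ 2) =
      m * a i ^ 2 + 2 * a i * ∑ j, a j + ∑ j, a j ^ 2 - 4 * a i ^ 2 := by
    intro i
    have h2 : ∀ j, (if i = j then 0 else (a i + a j) ^ 2) =
        (a i ^ 2 + 2 * a i * a j + a j ^ 2) - if i = j then 4 * a i ^ 2 else 0 := by
      intro j
      split_ifs with h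
      · subst h; ring
      · ring
    simp only [h2, Finset.sum_sub_distrib, Finset.sum_add_distrib, ← Finset.mul_sum,
      Finset.sum_ite_eq, Finset.mem_univ, if_true, Finset.sum_const, Finset.card_univ,
      Fintype.card_fin, nsmul_eq_mul]
  simp only [h1, Finset.sum_sub_distrib, Finset.sum_add_distrib, ← Finset.mul_sum, ← Finset.sum_mul,
    Finset.sum_const, Finset.card_univ, Fintype.card_fin, nsmul_eq_mul]
  ring

/-- Averaging over all pairs of face terms expresses the sum of `(a₀ + a₁)²` through the sum of
`a₀²` and the squared norm of the coboundary. -/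
theorem sum_faceTerm_zero_add_one_sq [Fintype V] {k : ℕ} {f : (Fin (k + 1) → V) → ℝ}
    (hf : IsAlternating f) (Q : (Fin (k + 2) → V) → Prop) [DecidablePred Q]
    (hQ : ∀ r (π : Equiv.Perm (Fin (k + 2))), Q (r ∘ π) ↔ Q r) :
    ((k : ℝ) + 2) * (k + 1) * ∑ r, (if Q r then (faceTerm f r 0 + faceTerm f r 1) ^ 2 else 0) =
      2 * k * (k + 2) * ∑ r, (if Q r then faceTerm f r 0 ^ 2 else 0) +
        2 * ∑ r, (if Q r then (∑ j, faceTerm f r j) ^ 2 else 0) := by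
  have h1 : ∑ i : Fin (k + 2), ∑ j : Fin (k + 2), (if i = j then 0 else
      ∑ r, (if Q r then (faceTerm f r i + faceTerm f r j) ^ 2 else 0)) =
      ((k : ℝ) + 2) * (k + 1) *
        ∑ r, (if Q r then (faceTerm f r 0 + faceTerm f r 1) ^ 2 else 0) := by
    have h2 : ∀ i j : Fin (k + 2), (if i = j then 0 else
        ∑ r, (if Q r then (faceTerm f r i + faceTerm f r j) ^ 2 else 0)) =
        (∑ r, (if Q r then (faceTerm f r 0 + faceTerm f r 1) ^ 2 else 0)) -
        if i = j then (∑ r, (if Q r then (faceTerm f r 0 + faceTerm f r 1) ^ 2 else 0)) else 0 := by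
      intro i j
      split_ifs with h
      · ring
      · rw [sum_faceTerm_add_sq_eq hf Q hQ h, sub_zero]
    simp only [h2, Finset.sum_sub_distrib, Finset.sum_ite_eq, Finset.mem_univ, if_true,
      Finset.sum_const, Finset.card_univ, Fintype.card_fin, nsmul_eq_mul]
    push_cast; ring
  have h3 : ∑ i : Fin (k + 2), ∑ j : Fin (k + 2), (if i = j then 0 else
      ∑ r, (if Q r then (faceTerm f r i + faceTerm f r j) ^ 2 else 0)) =
      ∑ r, (if Q r then ∑ i : Fin (k + 2), ∑ j : Fin (k + 2),
        (if i = j then 0 else (faceTerm f r i + faceTerm f r j) ^ 2) else 0) := by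
    have h2 : ∀ r, (if Q r then ∑ i : Fin (k + 2), ∑ j : Fin (k + 2),
        (if i = j then 0 else (faceTerm f r i + faceTerm f r j) ^ 2) else 0) =
        ∑ i : Fin (k + 2), ∑ j : Fin (k + 2), (if i = j then 0 else
          if Q r then (faceTerm f r i + faceTerm f r j) ^ 2 else 0) := by
      intro r; split_ifs <;> simp
    simp only [h2]
    symm
    rw [Finset.sum_comm]
    refine Finset.sum_congr rfl fun i _ => ?_
    rw [Finset.sum_comm]
    refine Finset.sum_congr rfl fun j _ => ?_
    split_ifs <;> simp
  have h4 : ∑ r, (if Q r then ∑ i, faceTerm f r i ^ 2 else 0) =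
      ((k : ℝ) + 2) * ∑ r, (if Q r then faceTerm f r 0 ^ 2 else 0) := by
    have : ∀ r, (if Q r then ∑ i, faceTerm f r i ^ 2 else 0) =
        ∑ i, (if Q r then faceTerm f r i ^ 2 else 0) := by
      intro r; split_ifs <;> simp
    simp only [this]
    rw [Finset.sum_comm]
    simp only [sum_faceTerm_sq_eq hf Q hQ, Finset.sum_const, Finset.card_univ, Fintype.card_fin,
      nsmul_eq_mul]
    push_cast; ring
  rw [← h1, h3]
  simp only [sum_add_sq_offDiag]
  have h5 : ∀ r, (if Q r then 2 * (((k + 2 : ℕ) : ℝ) - 2) * ∑ i, faceTerm f r i ^ 2 +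
      2 * (∑ i, faceTerm f r i) ^ 2 else 0) =
      2 * k * (if Q r then ∑ i, faceTerm f r i ^ 2 else 0) +
      2 * (if Q r then (∑ i, faceTerm f r i) ^ 2 else 0) := by
    intro r; split_ifs
    · push_cast; ring
    · ring
  simp only [h5, Finset.sum_add_distrib, ← Finset.mul_sum]
  rw [h4]; ring


/-! ### Counting the contributions of a simplex -/

theorem faceTerm_cons_zero {k : ℕ} (f : (Fin k → V) → ℝ) (v : V) (s : Fin k → V) :
    faceTerm f (Fin.cons v s : Fin (k + 1) → V) 0 = f s := by
  have : (Fin.cons v s : Fin (k + 1) → V) ∘ Fin.succAbove 0 = s := by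
    funext i; simp
  rw [faceTerm, this]; simp

theorem faceTerm_cons_cons_one {k : ℕ} (f : (Fin (k + 1) → V) → ℝ) (u v : V) (t : Fin k → V) :
    faceTerm f (Fin.cons u (Fin.cons v t : Fin (k + 1) → V) : Fin (k + 2) → V) 1 =
      - f (Fin.cons u t) := by
  have : (Fin.cons u (Fin.cons v t : Fin (k + 1) → V) : Fin (k + 2) → V) ∘ Fin.succAbove 1 =
      Fin.cons u t := by
    funext i
    induction i using Fin.cases with
    | zero => simp
    | succ i => rw [Function.comp_apply, Fin.one_succAbove_succ]; simp
  rw [faceTerm, this]; simp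

open scoped Classical in
/-- When summing `f(s)²` over the vertices `v` adjacent to a fixed entry of `s` for which `(v, s)` is
not a clique, the position of that entry does not matter, so one may average over the entries. -/
theorem sum_adj_not_clique [Fintype V] (G : SimpleGraph V) {k : ℕ} {f : (Fin (k + 1) → V) → ℝ}
    (hf : IsAlternating f) :
    ((k : ℝ) + 1) * ∑ s, ∑ v, (if G.Adj v (s 0) ∧ ¬ IsCliqueTuple G (Fin.cons v s : Fin (k + 2) → V)
        then f s ^ 2 else 0) =
      ∑ s, ∑ v, ∑ i, (if G.Adj v (s i) ∧ ¬ IsCliqueTuple G (Fin.cons v s : Fin (k + 2) → V)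
        then f s ^ 2 else 0) := by
  have h : ∀ i : Fin (k + 1), ∑ s, ∑ v, (if G.Adj v (s i) ∧
      ¬ IsCliqueTuple G (Fin.cons v s : Fin (k + 2) → V) then f s ^ 2 else 0) =
      ∑ s, ∑ v, (if G.Adj v (s 0) ∧ ¬ IsCliqueTuple G (Fin.cons v s : Fin (k + 2) → V)
        then f s ^ 2 else 0) := by
    intro i
    rw [← sum_comp_perm (fun s => ∑ v, (if G.Adj v (s 0) ∧
      ¬ IsCliqueTuple G (Fin.cons v s : Fin (k + 2) → V) then f s ^ 2 else 0)) (Equiv.swap 0 i)]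
    refine Finset.sum_congr rfl fun s _ => Finset.sum_congr rfl fun v _ => ?_
    have h1 : (∀ j, G.Adj v ((s ∘ Equiv.swap 0 i) j)) ↔ ∀ j, G.Adj v (s j) :=
      ⟨fun h j => by simpa using h (Equiv.swap 0 i j), fun h j => h _⟩
    have h2 : IsCliqueTuple G (Fin.cons v (s ∘ Equiv.swap 0 i) : Fin (k + 2) → V) ↔
        IsCliqueTuple G (Fin.cons v s : Fin (k + 2) → V) := by
      rw [isCliqueTuple_cons, isCliqueTuple_cons, h1, isCliqueTuple_comp_perm]
    simp only [h2, hf.sq_comp_perm, Function.comp_apply, Equiv.swap_apply_left]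
  have h' : ∑ s, ∑ v, ∑ i, (if G.Adj v (s i) ∧
      ¬ IsCliqueTuple G (Fin.cons v s : Fin (k + 2) → V) then f s ^ 2 else 0) =
      ∑ i, ∑ s, ∑ v, (if G.Adj v (s i) ∧
        ¬ IsCliqueTuple G (Fin.cons v s : Fin (k + 2) → V) then f s ^ 2 else 0) := by
    symm
    rw [Finset.sum_comm]
    exact Finset.sum_congr rfl fun s _ => Finset.sum_comm
  rw [h', Finset.sum_congr rfl fun i _ => h i]
  simp

open scoped Classical in
/-- Splitting the Laplacian energies of the functions `v ↦ f(v, t)` into cliques and non-cliques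
`(u, v, t)`. In the second case at most one of `f(u, t)` and `f(v, t)` is nonzero, and the two
contributions agree by symmetry. -/
theorem sum_adj_sub_sq_le [Fintype V] (G : SimpleGraph V) {k : ℕ} {f : (Fin (k + 1) → V) → ℝ}
    (hsupp : ∀ s, f s ≠ 0 → IsCliqueTuple G s) :
    ∑ t : Fin k → V, ∑ u, ∑ v,
        (if G.Adj u v then (f (Fin.cons u t) - f (Fin.cons v t)) ^ 2 else 0) ≤
      ∑ r : Fin (k + 2) → V,
        (if IsCliqueTuple G r then (faceTerm f r 0 + faceTerm f r 1) ^ 2 else 0) +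
      2 * ∑ s, ∑ v, (if G.Adj v (s 0) ∧ ¬ IsCliqueTuple G (Fin.cons v s : Fin (k + 2) → V)
        then f s ^ 2 else 0) := by
  have hpt : ∀ (t : Fin k → V) (u v : V),
      (if G.Adj u v then (f (Fin.cons u t) - f (Fin.cons v t)) ^ 2 else 0) ≤
      (if IsCliqueTuple G (Fin.cons u (Fin.cons v t : Fin (k + 1) → V) : Fin (k + 2) → V) then
        (f (Fin.cons v t) + - f (Fin.cons u t)) ^ 2 else 0) +
      ((if G.Adj u v ∧ ¬ IsCliqueTuple G
        (Fin.cons u (Fin.cons v t : Fin (k + 1) → V) : Fin (k + 2) → V) then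
          f (Fin.cons v t) ^ 2 else 0) +
      (if G.Adj v u ∧ ¬ IsCliqueTuple G
        (Fin.cons v (Fin.cons u t : Fin (k + 1) → V) : Fin (k + 2) → V) then
          f (Fin.cons u t) ^ 2 else 0)) := by
    intro t u v
    rw [isCliqueTuple_cons_cons_comm v u, G.adj_comm v u]
    by_cases hadj : G.Adj u v
    · by_cases hE : IsCliqueTuple G
        (Fin.cons u (Fin.cons v t : Fin (k + 1) → V) : Fin (k + 2) → V)
      · simp only [hadj, hE, if_true, not_true, and_false, if_false]
        apply le_of_eq; ring
      · simp only [hadj, hE, if_true, not_false_iff, and_true, if_false]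
        -- if both values were nonzero then `u`, `v`, `t` would form a clique
        have h0 : f (Fin.cons u t) = 0 ∨ f (Fin.cons v t) = 0 := by
          by_contra! h
          have hu := (isCliqueTuple_cons u t).mp (hsupp _ h.1)
          have hv := hsupp _ h.2
          refine hE ((isCliqueTuple_cons _ _).mpr ⟨fun i => ?_, hv⟩)
          induction i using Fin.cases with
          | zero => simpa using hadj
          | succ i => simpa using hu.1 i
        rcases h0 with h | h <;> rw [h] <;> apply le_of_eq <;> ring
    · rw [if_neg hadj]
      positivity
  have h1 : ∑ t : Fin k → V, ∑ u, ∑ v,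
      (if IsCliqueTuple G (Fin.cons u (Fin.cons v t : Fin (k + 1) → V) : Fin (k + 2) → V) then
        (f (Fin.cons v t) + - f (Fin.cons u t)) ^ 2 else 0) =
      ∑ r : Fin (k + 2) → V,
        (if IsCliqueTuple G r then (faceTerm f r 0 + faceTerm f r 1) ^ 2 else 0) := by
    rw [sum_cons, Finset.sum_comm]
    refine Finset.sum_congr rfl fun u _ => ?_
    rw [sum_cons, Finset.sum_comm]
    simp only [faceTerm_cons_zero, faceTerm_cons_cons_one]
  have h2 : ∑ t : Fin k → V, ∑ u, ∑ v,
      (if G.Adj u v ∧ ¬ IsCliqueTuple G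
        (Fin.cons u (Fin.cons v t : Fin (k + 1) → V) : Fin (k + 2) → V) then
          f (Fin.cons v t) ^ 2 else 0) =
      ∑ s, ∑ v, (if G.Adj v (s 0) ∧ ¬ IsCliqueTuple G (Fin.cons v s : Fin (k + 2) → V)
        then f s ^ 2 else 0) := by
    symm
    rw [sum_cons, Finset.sum_comm]
    simp only [Fin.cons_zero]
    exact Finset.sum_congr rfl fun t _ => Finset.sum_comm
  have h3 : ∑ t : Fin k → V, ∑ u, ∑ v,
      (if G.Adj v u ∧ ¬ IsCliqueTuple G
        (Fin.cons v (Fin.cons u t : Fin (k + 1) → V) : Fin (k + 2) → V) then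
          f (Fin.cons u t) ^ 2 else 0) =
      ∑ s, ∑ v, (if G.Adj v (s 0) ∧ ¬ IsCliqueTuple G (Fin.cons v s : Fin (k + 2) → V)
        then f s ^ 2 else 0) := by
    rw [← h2]
    exact Finset.sum_congr rfl fun t _ => Finset.sum_comm
  refine (Finset.sum_le_sum fun t _ => Finset.sum_le_sum fun u _ =>
    Finset.sum_le_sum fun v _ => hpt t u v).trans ?_
  simp only [Finset.sum_add_distrib]
  rw [h1, h2, h3]
  apply le_of_eq; ring

open scoped Classical in
/-- For a clique tuple `s`, a vertex `v` with `(v, s)` a clique contributes `k`, and any other vertex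
is adjacent to at most `k` of the `k + 1` entries of `s`. -/
theorem clique_or_adj_le [Fintype V] (G : SimpleGraph V) {k : ℕ} {s : Fin (k + 1) → V}
    (hs : IsCliqueTuple G s) (v : V) {c : ℝ} (hc : 0 ≤ c) :
    k * (if IsCliqueTuple G (Fin.cons v s : Fin (k + 2) → V) then c else 0) +
      ∑ i, (if G.Adj v (s i) ∧ ¬ IsCliqueTuple G (Fin.cons v s : Fin (k + 2) → V)
        then c else 0) ≤ k * c := by
  by_cases hE : IsCliqueTuple G (Fin.cons v s : Fin (k + 2) → V)
  · simp [hE]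
  · obtain ⟨i, hi⟩ : ∃ i, ¬ G.Adj v (s i) := by
      by_contra! h
      exact hE ((isCliqueTuple_cons v s).mpr ⟨h, hs⟩)
    simp only [hE, if_false, not_false_iff, and_true, mul_zero, zero_add]
    rw [← Finset.add_sum_erase _ _ (Finset.mem_univ i), if_neg hi, zero_add]
    calc _ ≤ ∑ _j ∈ Finset.univ.erase i, c :=
          Finset.sum_le_sum fun j _ => by split_ifs <;> linarith
      _ = k * c := by simp

open scoped Classical in
/-- If `f` is a cocycle off the set `P` of missing cliques, its coboundary is controlled by the number
`D` of missing cliques that contain a given simplex: apply the Cauchy-Schwarz inequality on `P`. -/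
theorem sum_coboundary_sq_le [Fintype V] (G : SimpleGraph V) {k : ℕ} {f : (Fin (k + 1) → V) → ℝ}
    (hf : IsAlternating f) (P : (Fin (k + 2) → V) → Prop)
    (hP : ∀ r (π : Equiv.Perm (Fin (k + 2))), P (r ∘ π) ↔ P r)
    (hδ : ∀ r, IsCliqueTuple G r → ¬ P r → ∑ j, faceTerm f r j = 0) (D : ℕ)
    (hD : ∀ s, f s ≠ 0 → Finset.card {u : V | IsCliqueTuple G (Fin.cons u s : Fin (k + 2) → V) ∧
      P (Fin.cons u s)} ≤ D) :
    ∑ r, (if IsCliqueTuple G r then (∑ j, faceTerm f r j) ^ 2 else 0) ≤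
      ((k : ℝ) + 2) ^ 2 * D * ∑ s, f s ^ 2 := by
  have hQ : ∀ r (π : Equiv.Perm (Fin (k + 2))),
      (IsCliqueTuple G (r ∘ π) ∧ P (r ∘ π)) ↔ (IsCliqueTuple G r ∧ P r) := by
    intro r π; rw [isCliqueTuple_comp_perm, hP]
  have h1 : ∀ r, (if IsCliqueTuple G r then (∑ j, faceTerm f r j) ^ 2 else 0) ≤
      ((k : ℝ) + 2) * ∑ j, if IsCliqueTuple G r ∧ P r then faceTerm f r j ^ 2 else 0 := by
    intro r
    by_cases hr : IsCliqueTuple G r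
    · by_cases hp : P r
      · simp only [hr, hp, and_self, if_true]
        have h := sq_sum_le_card_mul_sum_sq (s := Finset.univ) (f := faceTerm f r)
        rw [Finset.card_univ, Fintype.card_fin] at h
        push_cast at h
        exact h.trans (le_of_eq (by ring))
      · simp [hr, hp, hδ r hr hp]
    · simp [hr]
  have h2 : ∑ r, (if IsCliqueTuple G r ∧ P r then faceTerm f r 0 ^ 2 else 0) ≤
      D * ∑ s, f s ^ 2 := by
    rw [sum_cons, Finset.sum_comm, Finset.mul_sum]
    refine Finset.sum_le_sum fun s _ => ?_
    simp only [faceTerm_cons_zero]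
    by_cases h0 : f s = 0
    · simp [h0]
    · rw [← Finset.sum_filter, Finset.sum_const, nsmul_eq_mul]
      exact mul_le_mul_of_nonneg_right (by exact_mod_cast hD s h0) (sq_nonneg _)
  calc _ ≤ ∑ r, ((k : ℝ) + 2) * ∑ j, (if IsCliqueTuple G r ∧ P r then faceTerm f r j ^ 2 else 0) :=
        Finset.sum_le_sum fun r _ => h1 r
    _ = ((k : ℝ) + 2) ^ 2 * ∑ r, (if IsCliqueTuple G r ∧ P r then faceTerm f r 0 ^ 2 else 0) := by
        rw [← Finset.mul_sum, Finset.sum_comm]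
        simp only [sum_faceTerm_sq_eq hf (fun r => IsCliqueTuple G r ∧ P r) hQ, Finset.sum_const,
          Finset.card_univ, Fintype.card_fin, nsmul_eq_mul]
        push_cast; ring
    _ ≤ _ := by
        rw [mul_assoc]
        exact mul_le_mul_of_nonneg_left h2 (by positivity)

open scoped Classical in
/-- The main estimate: if the functions `v ↦ f(v, t)` satisfy the variational inequality with
constant `c`, and `f` is a cocycle away from the missing cliques `P`, then
`(k + 1) c ‖f‖² ≤ (k n + (k + 2) D) ‖f‖²`. -/
theorem gap_mul_sum_sq_le [Fintype V] (G : SimpleGraph V) {k : ℕ} {f : (Fin (k + 1) → V) → ℝ}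
    (hf : IsAlternating f) (hsupp : ∀ s, f s ≠ 0 → IsCliqueTuple G s)
    (P : (Fin (k + 2) → V) → Prop)
    (hP : ∀ r (π : Equiv.Perm (Fin (k + 2))), P (r ∘ π) ↔ P r)
    (hδ : ∀ r, IsCliqueTuple G r → ¬ P r → ∑ j, faceTerm f r j = 0) (D : ℕ)
    (hD : ∀ s, f s ≠ 0 → Finset.card {u : V | IsCliqueTuple G (Fin.cons u s : Fin (k + 2) → V) ∧
      P (Fin.cons u s)} ≤ D) (c : ℝ)
    (hgap : ∀ t : Fin k → V, c * ∑ v, f (Fin.cons v t) ^ 2 ≤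
      (∑ u, ∑ v, if G.Adj u v then (f (Fin.cons u t) - f (Fin.cons v t)) ^ 2 else 0) / 2) :
    (k + 1) * c * ∑ s, f s ^ 2 ≤ (k * Fintype.card V + (k + 2) * D) * ∑ s, f s ^ 2 := by
  set S := ∑ s, f s ^ 2 with hS
  have h1 : c * S ≤ (∑ t : Fin k → V, ∑ u, ∑ v,
      if G.Adj u v then (f (Fin.cons u t) - f (Fin.cons v t)) ^ 2 else 0) / 2 := by
    rw [hS, sum_cons, Finset.sum_comm, Finset.mul_sum, Finset.sum_div]
    exact Finset.sum_le_sum fun t _ => hgap t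
  have h2 := sum_adj_sub_sq_le G hsupp
  have h3 := sum_faceTerm_zero_add_one_sq hf (IsCliqueTuple G) isCliqueTuple_comp_perm
  have h4 := sum_coboundary_sq_le G hf P hP hδ D hD
  have h5 := sum_adj_not_clique G hf
  have h6 : k * ∑ r : Fin (k + 2) → V, (if IsCliqueTuple G r then faceTerm f r 0 ^ 2 else 0) +
      ∑ s, ∑ v, ∑ i, (if G.Adj v (s i) ∧ ¬ IsCliqueTuple G (Fin.cons v s : Fin (k + 2) → V)
        then f s ^ 2 else 0) ≤ k * Fintype.card V * S := by
    rw [sum_cons, Finset.sum_comm, Finset.mul_sum, ← Finset.sum_add_distrib, hS, Finset.mul_sum]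
    refine Finset.sum_le_sum fun s _ => ?_
    simp only [faceTerm_cons_zero]
    by_cases h0 : f s = 0
    · simp [h0]
    · rw [Finset.mul_sum, ← Finset.sum_add_distrib]
      refine (Finset.sum_le_sum fun v _ =>
        clique_or_adj_le G (hsupp s h0) v (sq_nonneg (f s))).trans (le_of_eq ?_)
      simp; ring
  rw [← hS] at h4
  generalize (∑ t : Fin k → V, ∑ u, ∑ v,
      if G.Adj u v then (f (Fin.cons u t) - f (Fin.cons v t)) ^ 2 else 0) = T at h1 h2
  generalize ∑ r : Fin (k + 2) → V,
    (if IsCliqueTuple G r then (faceTerm f r 0 + faceTerm f r 1) ^ 2 else 0) = A at h2 h3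
  generalize ∑ s, ∑ v, (if G.Adj v (s 0) ∧ ¬ IsCliqueTuple G (Fin.cons v s : Fin (k + 2) → V)
        then f s ^ 2 else 0) = B at h2 h5
  generalize ∑ r : Fin (k + 2) → V, (if IsCliqueTuple G r then (∑ j, faceTerm f r j) ^ 2 else 0) = C
    at h3 h4
  generalize ∑ r : Fin (k + 2) → V, (if IsCliqueTuple G r then faceTerm f r 0 ^ 2 else 0) = E
    at h3 h6
  rw [← h5] at h6
  have hk : (0 : ℝ) < (k : ℝ) + 2 := by positivity
  have hA : (k + 1) * A ≤ 2 * k * E + 2 * (k + 2) * D * S := by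
    refine le_of_mul_le_mul_left ?_ hk
    nlinarith
  have hk1 : (0 : ℝ) ≤ (k : ℝ) + 1 := by positivity
  -- by `hA` the right-hand side is at most `2 (k E + (k + 1) B) + 2 (k + 2) D S`, and `h6` bounds
  -- `k E + (k + 1) B` by `k n S`
  have h7 : (k + 1) * (2 * c * S) ≤ (k + 1) * (A + 2 * B) :=
    mul_le_mul_of_nonneg_left (by linarith) hk1
  nlinarith

end TupleCochain

/-! ### Cochains as functions on tuples -/

namespace AbstractSimplicialComplex

open TupleCochain

variable {V : Type*} {X : AbstractSimplicialComplex V} {k : ℕ}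

theorem OrderedSimplex.coe_injective :
    Function.Injective fun σ : X.OrderedSimplex k => (σ.1 : Fin (k + 1) → V) :=
  fun _ _ h => Subtype.ext (DFunLike.coe_injective h)

open scoped Classical in
/-- The extension by zero of a cochain to all ordered tuples of vertices. -/
noncomputable def Cochain.zeroExtend : X.Cochain k →ₗ[ℝ] ((Fin (k + 1) → V) → ℝ) where
  toFun φ s := if h : ∃ σ : X.OrderedSimplex k, σ.1 = s then φ.1 h.choose else 0
  map_add' φ ψ := by
    funext s
    simp only [Pi.add_apply]
    split_ifs
    · rfl
    · simp
  map_smul' c φ := by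
    funext s
    simp only [Pi.smul_apply, RingHom.id_apply]
    split_ifs
    · rfl
    · simp

theorem Cochain.zeroExtend_coe (φ : X.Cochain k) (σ : X.OrderedSimplex k) :
    zeroExtend φ σ.1 = φ.1 σ := by
  have h : ∃ τ : X.OrderedSimplex k, (τ.1 : Fin (k + 1) → V) = σ.1 := ⟨σ, rfl⟩
  have h1 : h.choose = σ := OrderedSimplex.coe_injective h.choose_spec
  exact (dif_pos h).trans (congrArg φ.1 h1)

theorem Cochain.zeroExtend_of_not_exists (φ : X.Cochain k) {s : Fin (k + 1) → V}
    (h : ¬ ∃ σ : X.OrderedSimplex k, σ.1 = s) : zeroExtend φ s = 0 :=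
  dif_neg h

theorem Cochain.exists_of_zeroExtend_ne_zero {φ : X.Cochain k} {s : Fin (k + 1) → V}
    (h : zeroExtend φ s ≠ 0) : ∃ σ : X.OrderedSimplex k, σ.1 = s := by
  by_contra h0
  exact h (zeroExtend_of_not_exists φ h0)

theorem Cochain.zeroExtend_injective :
    Function.Injective (zeroExtend : X.Cochain k →ₗ[ℝ] ((Fin (k + 1) → V) → ℝ)) := by
  intro φ ψ h
  apply Subtype.ext
  funext σ
  rw [← zeroExtend_coe, ← zeroExtend_coe, h]

theorem OrderedSimplex.exists_comp_perm_iff (s : Fin (k + 1) → V) (π : Equiv.Perm (Fin (k + 1))) :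
    (∃ σ : X.OrderedSimplex k, σ.1 = s ∘ π) ↔ ∃ σ : X.OrderedSimplex k, σ.1 = s := by
  constructor
  · rintro ⟨σ, h⟩
    refine ⟨σ.reorder π⁻¹, ?_⟩
    change σ.1 ∘ (π⁻¹ : Equiv.Perm _) = s
    rw [h]; funext i; simp
  · rintro ⟨σ, rfl⟩
    exact ⟨σ.reorder π, rfl⟩

theorem Cochain.isAlternating_zeroExtend (φ : X.Cochain k) : IsAlternating (zeroExtend φ) := by
  intro s π
  by_cases h : ∃ σ : X.OrderedSimplex k, σ.1 = s
  · obtain ⟨σ, rfl⟩ := h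
    rw [zeroExtend_coe, ← φ.2 σ π]
    exact zeroExtend_coe φ (σ.reorder π)
  · rw [zeroExtend_of_not_exists φ h, mul_zero, zeroExtend_of_not_exists]
    rwa [OrderedSimplex.exists_comp_perm_iff]

theorem Cochain.zeroExtend_coboundary (φ : X.Cochain k) (σ : X.OrderedSimplex (k + 1)) :
    zeroExtend (X.coboundary k φ) σ.1 = ∑ j, faceTerm (zeroExtend φ) σ.1 j := by
  rw [zeroExtend_coe]
  change ∑ j : Fin (k + 2), (-1) ^ (j : ℕ) * φ.1 (σ.face j) = _
  refine Finset.sum_congr rfl fun j _ => ?_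
  rw [← zeroExtend_coe φ (σ.face j)]
  rfl

/-! ### The complex and the adjoint coboundary -/

theorem coboundary_coboundary (φ : X.Cochain k) :
    X.coboundary (k + 1) (X.coboundary k φ) = 0 := by
  apply Subtype.ext
  funext s
  change ∑ i : Fin (k + 3), (-1) ^ (i : ℕ) *
    ∑ j : Fin (k + 2), (-1) ^ (j : ℕ) * φ.1 ((s.face i).face j) = (0 : ℝ)
  simp only [Finset.mul_sum]
  rw [← Fintype.sum_prod_type']
  -- deleting two vertices in either order gives the same face with opposite signs
  refine Finset.sum_involution (fun p _ => (p.1.succAbove p.2, p.2.predAbove p.1)) ?_ ?_ ?_ ?_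
  · rintro ⟨i, j⟩ -
    have h1 : (s.face (i.succAbove j)).face (j.predAbove i) = (s.face i).face j := by
      apply OrderedSimplex.coe_injective
      funext l
      exact congrArg s.1 (Fin.succAbove_succAbove_succAbove_predAbove i j l)
    have h2 := Fin.neg_one_pow_succAbove_add_predAbove (R := ℝ) i j
    simp only [h1, ← mul_assoc, ← pow_add, h2]
    ring
  · rintro ⟨i, j⟩ - - h
    exact Fin.succAbove_ne i j (congrArg Prod.fst h)
  · simp
  · rintro ⟨i, j⟩ -
    simp [Fin.succAbove_succAbove_predAbove, Fin.predAbove_predAbove_succAbove]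

/-- The adjoint coboundary of a cochain (up to a positive factor): `ψ(t) = ∑_v φ(v, t)`, where `φ`
is extended by zero. -/
noncomputable def Cochain.codifferential [Fintype V] (φ : X.Cochain (k + 1)) : X.Cochain k :=
  ⟨fun σ => ∑ v, zeroExtend φ (Fin.cons v σ.1), by
    intro σ π
    rw [Finset.mul_sum]
    refine Finset.sum_congr rfl fun v _ => ?_
    have h1 : (Fin.cons v (σ.reorder π).1 : Fin (k + 2) → V) =
        (Fin.cons v σ.1 : Fin (k + 2) → V) ∘ Equiv.Perm.decomposeFin.symm (0, π) := by
      funext i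
      induction i using Fin.cases with
      | zero => simp
      | succ i => simp [OrderedSimplex.reorder]
    rw [h1, isAlternating_zeroExtend, Equiv.Perm.decomposeFin.symm_sign]
    simp⟩

theorem Cochain.zeroExtend_codifferential [Fintype V] (φ : X.Cochain (k + 1))
    (t : Fin (k + 1) → V) :
    zeroExtend φ.codifferential t = ∑ v, zeroExtend φ (Fin.cons v t) := by
  by_cases h : ∃ σ : X.OrderedSimplex k, σ.1 = t
  · obtain ⟨σ, rfl⟩ := h
    rw [zeroExtend_coe]; rfl
  · rw [zeroExtend_of_not_exists _ h]
    symm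
    refine Finset.sum_eq_zero fun v _ => zeroExtend_of_not_exists _ ?_
    rintro ⟨σ, hσ⟩
    refine h ⟨σ.face 0, ?_⟩
    change σ.1 ∘ Fin.succAbove 0 = t
    rw [hσ]; funext i; simp

/-- The pairing of `φ` with the coboundary of its codifferential `ψ` is `k + 2` times the squared norm
of `ψ`, where tuples of both lengths carry the counting measure. -/
theorem Cochain.sum_zeroExtend_mul_coboundary_codifferential [Fintype V] (φ : X.Cochain (k + 1)) :
    ∑ r, zeroExtend φ r * zeroExtend (X.coboundary k φ.codifferential) r =
      ((k : ℝ) + 2) * ∑ t, zeroExtend φ.codifferential t ^ 2 := by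
  set ψ := φ.codifferential with hψ
  have h1 : ∀ r, zeroExtend φ r * zeroExtend (X.coboundary k ψ) r =
      ∑ j, zeroExtend φ r * faceTerm (zeroExtend ψ) r j := by
    intro r
    rw [← Finset.mul_sum]
    by_cases h : ∃ σ : X.OrderedSimplex (k + 1), σ.1 = r
    · obtain ⟨σ, rfl⟩ := h
      rw [zeroExtend_coboundary]
    · rw [zeroExtend_of_not_exists φ h, zero_mul, zero_mul]
  have h2 : ∀ j : Fin (k + 2), ∑ r, zeroExtend φ r * faceTerm (zeroExtend ψ) r j =
      ∑ r, zeroExtend φ r * faceTerm (zeroExtend ψ) r 0 := by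
    intro j
    rw [← sum_comp_perm (fun r => zeroExtend φ r * faceTerm (zeroExtend ψ) r 0) (Equiv.swap 0 j)]
    refine Finset.sum_congr rfl fun r _ => ?_
    rw [φ.isAlternating_zeroExtend, ψ.isAlternating_zeroExtend.faceTerm_comp_perm,
      Equiv.swap_apply_left]
    linear_combination (-(zeroExtend φ r * faceTerm (zeroExtend ψ) r j)) *
      sign_sq (Equiv.swap 0 j)
  have h3 : ∑ r, zeroExtend φ r * faceTerm (zeroExtend ψ) r 0 = ∑ t, zeroExtend ψ t ^ 2 := by
    rw [sum_cons, Finset.sum_comm]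
    refine Finset.sum_congr rfl fun t _ => ?_
    simp only [faceTerm_cons_zero]
    rw [← Finset.sum_mul, ← zeroExtend_codifferential, pow_two]
  simp only [h1]
  rw [Finset.sum_comm]
  simp only [h2, h3, Finset.sum_const, Finset.card_univ, Fintype.card_fin, nsmul_eq_mul]
  push_cast; ring

/-- A cochain orthogonal to all coboundaries has vanishing codifferential. -/
theorem Cochain.sum_zeroExtend_cons_eq_zero [Fintype V] (φ : X.Cochain (k + 1))
    (h : ∀ χ : X.Cochain k, ∑ r, zeroExtend φ r * zeroExtend (X.coboundary k χ) r = 0)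
    (t : Fin (k + 1) → V) : ∑ v, zeroExtend φ (Fin.cons v t) = 0 := by
  have h1 := φ.sum_zeroExtend_mul_coboundary_codifferential
  rw [h] at h1
  have h2 : ∑ t, zeroExtend φ.codifferential t ^ 2 = 0 := by
    rcases mul_eq_zero.mp h1.symm with h0 | h0
    · have : (0 : ℝ) < (k : ℝ) + 2 := by positivity
      linarith
    · exact h0
  rw [← zeroExtend_codifferential]
  exact pow_eq_zero_iff two_ne_zero |>.mp
    ((Finset.sum_eq_zero_iff_of_nonneg fun _ _ => sq_nonneg _).mp h2 t (Finset.mem_univ t))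

/-! ### Missing simplices and harmonic cochains -/

theorem OrderedSimplex.isCliqueTuple (σ : X.OrderedSimplex k) :
    IsCliqueTuple X.oneSkeleton σ.1 := by
  classical
  intro i j hij
  refine ⟨fun e => hij (σ.1.injective e), (X.isRelLowerSet_faces σ.2).2 ?_ ⟨σ.1 i, by simp⟩⟩
  intro x hx
  rcases Finset.mem_insert.mp hx with rfl | hx
  · simp
  · rw [Finset.mem_singleton.mp hx]; simp

theorem exists_orderedSimplex_cons {σ : X.OrderedSimplex k} {u : V} [DecidableEq V]
    (hu : ∀ i, u ≠ σ.1 i) (h : Finset.univ.map σ.1 ∪ {u} ∈ X.faces) :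
    ∃ τ : X.OrderedSimplex (k + 1), τ.1 = (Fin.cons u σ.1 : Fin (k + 2) → V) := by
  have hinj : Function.Injective (Fin.cons u σ.1 : Fin (k + 2) → V) := by
    rw [Fin.cons_injective_iff]
    exact ⟨fun ⟨i, hi⟩ => hu i hi.symm, σ.1.injective⟩
  refine ⟨⟨⟨_, hinj⟩, ?_⟩, rfl⟩
  convert h using 1
  ext x
  simp [Fin.exists_fin_succ, eq_comm]

open scoped Classical in
/-- If `u` extends the simplex `σ` to a clique but not to a simplex, then `u` is one of the vertices
counted by the clique defect. -/
theorem card_missing_le_cliqueDefect [Fintype V]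
    (hskel : X.skeleton k = (cliqueComplex X.oneSkeleton).skeleton k) (σ : X.OrderedSimplex k) :
    Finset.card {u : V | IsCliqueTuple X.oneSkeleton (Fin.cons u σ.1 : Fin (k + 2) → V) ∧
      ¬ ∃ τ : X.OrderedSimplex (k + 1), τ.1 = (Fin.cons u σ.1 : Fin (k + 2) → V)} ≤
      X.cliqueDefect k (k + 1) := by
  have hcard : (Finset.univ.map σ.1).card = k + 1 := by simp
  have hmem : Finset.univ.map σ.1 ∈ X.simplices k := by
    simp only [simplices, Finset.mem_filter, Finset.mem_univ, true_and]
    exact ⟨σ.2, hcard⟩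
  refine le_trans (Finset.card_le_card ?_) (Finset.le_sup (f := fun σ : Finset V =>
    Finset.card {u : V | {u} ∉ (X.link σ).faces ∧
      Finset.card {v ∈ σ | {u} ∈ (X.link (σ \ {v})).faces} = k + 1}) hmem)
  intro u hu
  simp only [Finset.mem_filter, Finset.mem_univ, true_and] at hu ⊢
  obtain ⟨hu, hnot⟩ := hu
  have hadj := ((isCliqueTuple_cons _ _).mp hu).1
  have hne : ∀ i, u ≠ σ.1 i := fun i => (hadj i).ne
  refine ⟨fun h => hnot (exists_orderedSimplex_cons hne h.2.1), ?_⟩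
  rw [Finset.filter_true_of_mem, hcard]
  intro v hv
  refine ⟨X.singleton_mem u, ?_, ?_⟩
  · -- a clique on `k + 1` vertices is a simplex because the `k`-skeleta agree
    have : Finset.univ.map σ.1 \ {v} ∪ {u} ∈ (X.skeleton k).faces := by
      rw [hskel]
      refine ⟨⟨⟨u, by simp⟩, ?_⟩, ?_⟩
      · intro x hx y hy hxy
        simp only [Finset.coe_union, Finset.coe_sdiff, Finset.coe_map, Finset.coe_univ,
          Set.image_univ, Finset.coe_singleton, Set.mem_union, Set.mem_sdiff, Set.mem_range,
          Set.mem_singleton_iff] at hx hy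
        rcases hx with ⟨⟨i, rfl⟩, -⟩ | rfl <;> rcases hy with ⟨⟨j, rfl⟩, -⟩ | rfl
        · exact σ.isCliqueTuple i j fun e => hxy (by rw [e])
        · exact (hadj i).symm
        · exact hadj j
        · exact absurd rfl hxy
      · refine (Finset.card_union_le _ _).trans ?_
        rw [Finset.card_sdiff_of_subset (Finset.singleton_subset_iff.mpr hv), hcard]
        simp
    exact this.1
  · rw [← Finset.disjoint_iff_inter_eq_empty, Finset.disjoint_singleton_right]
    intro h
    obtain ⟨i, -, hi⟩ := Finset.mem_map.mp (Finset.mem_sdiff.mp h).1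
    exact hne i hi.symm

/-- A harmonic cochain vanishes under the spectral gap condition. -/
theorem Cochain.eq_zero_of_harmonic [Fintype V]
    (hskel : X.skeleton (k + 1) = (cliqueComplex X.oneSkeleton).skeleton (k + 1))
    (hgap : X.oneSkeleton.spectralGap >
      ((k + 1 : ℕ) : ℝ) * (Fintype.card V : ℝ) / (((k + 1 : ℕ) : ℝ) + 1) +
        (((k + 1 : ℕ) : ℝ) + 1) * (X.cliqueDefect (k + 1) (k + 1 + 1) : ℝ))
    (φ : X.Cochain (k + 1)) (hφ : X.coboundary (k + 1) φ = 0)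
    (horth : ∀ χ : X.Cochain k, ∑ r, zeroExtend φ r * zeroExtend (X.coboundary k χ) r = 0) :
    φ = 0 := by
  classical
  set D := X.cliqueDefect (k + 1) (k + 1 + 1) with hDdef
  have hpos : 0 < X.oneSkeleton.spectralGap := lt_of_le_of_lt (by positivity) hgap
  have key := gap_mul_sum_sq_le X.oneSkeleton φ.isAlternating_zeroExtend
    (fun s hs => by
      obtain ⟨σ, rfl⟩ := exists_of_zeroExtend_ne_zero hs
      exact σ.isCliqueTuple)
    (fun r => ¬ ∃ τ : X.OrderedSimplex (k + 1 + 1), τ.1 = r)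
    (fun r π => by rw [OrderedSimplex.exists_comp_perm_iff])
    (fun r _ hr => by
      obtain ⟨τ, rfl⟩ := not_not.mp hr
      rw [← zeroExtend_coboundary, hφ, map_zero]; rfl)
    D
    (fun s hs => by
      obtain ⟨σ, rfl⟩ := exists_of_zeroExtend_ne_zero hs
      convert card_missing_le_cliqueDefect hskel σ)
    X.oneSkeleton.spectralGap
    (fun t => by
      convert X.oneSkeleton.spectralGap_mul_sum_sq_le hpos (fun v => zeroExtend φ (Fin.cons v t))
        (φ.sum_zeroExtend_cons_eq_zero horth t))
  have hS : ∑ s, zeroExtend φ s ^ 2 = 0 := by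
    by_contra hne
    have hSpos : 0 < ∑ s, zeroExtend φ s ^ 2 :=
      lt_of_le_of_ne (Finset.sum_nonneg fun _ _ => sq_nonneg _) (Ne.symm hne)
    have h1 := le_of_mul_le_mul_right key hSpos
    have hk1 : (0 : ℝ) < ((k + 1 : ℕ) : ℝ) + 1 := by positivity
    have h2 := mul_lt_mul_of_pos_left hgap hk1
    rw [mul_add, mul_div_cancel₀ _ hk1.ne'] at h2
    push_cast at h1 h2
    have hk : (0 : ℝ) ≤ (k : ℝ) := by positivity
    have hD : (0 : ℝ) ≤ (D : ℝ) := by positivity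
    -- with `K = k + 1 ≥ 1` the degree, `K + 2 ≤ (K + 1)²`
    nlinarith [mul_nonneg hk hD, mul_nonneg (mul_nonneg hk hk) hD]
  apply zeroExtend_injective
  rw [map_zero]
  funext s
  exact pow_eq_zero_iff two_ne_zero |>.mp
    ((Finset.sum_eq_zero_iff_of_nonneg fun _ _ => sq_nonneg _).mp hS s (Finset.mem_univ s))

/-- Every cochain is the sum of a coboundary and a cochain orthogonal to all coboundaries. -/
theorem Cochain.exists_sub_coboundary_orthogonal [Fintype V] (φ : X.Cochain (k + 1)) :
    ∃ ψ : X.Cochain k, ∀ χ : X.Cochain k,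
      ∑ r, zeroExtend (φ - X.coboundary k ψ) r * zeroExtend (X.coboundary k χ) r = 0 := by
  classical
  let ι : X.Cochain (k + 1) →ₗ[ℝ] EuclideanSpace ℝ (Fin (k + 1 + 1) → V) :=
    (WithLp.linearEquiv 2 ℝ ((Fin (k + 1 + 1) → V) → ℝ)).symm.toLinearMap ∘ₗ zeroExtend
  let W := LinearMap.range (ι ∘ₗ X.coboundary k)
  obtain ⟨ψ, hψ⟩ : W.starProjection (ι φ) ∈ W := W.starProjection_apply_mem (ι φ)
  refine ⟨ψ, fun χ => ?_⟩
  have h := W.sub_starProjection_mem_orthogonal (ι φ)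
  rw [← hψ] at h
  have h1 := (Submodule.mem_orthogonal' _ _).mp h (ι (X.coboundary k χ)) ⟨χ, rfl⟩
  rw [LinearMap.comp_apply ι, ← map_sub ι, EuclideanSpace.inner_eq_star_dotProduct] at h1
  rw [← h1]
  refine Finset.sum_congr rfl fun r _ => ?_
  rw [mul_comm]
  rfl

end AbstractSimplicialComplex

theorem corollary1p7 {V : Type*} [Fintype V] (X : AbstractSimplicialComplex V)
    (hconn : X.oneSkeleton.Connected) (k : ℕ) (hk : 1 ≤ k)
    (hskel : X.skeleton k =
      (AbstractSimplicialComplex.cliqueComplex X.oneSkeleton).skeleton k)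
    (hgap : X.oneSkeleton.spectralGap >
      (k : ℝ) * (Fintype.card V : ℝ) / ((k : ℝ) + 1) +
        ((k : ℝ) + 1) * (X.cliqueDefect k (k + 1) : ℝ)) :
    Subsingleton (X.ReducedCohomology k) := by
  obtain ⟨m, rfl⟩ : ∃ m, k = m + 1 := ⟨k - 1, by omega⟩
  rw [Submodule.Quotient.subsingleton_iff, eq_top_iff]
  rintro ⟨φ, hφ⟩ -
  obtain ⟨ψ, hψ⟩ := φ.exists_sub_coboundary_orthogonal
  have h0 := AbstractSimplicialComplex.Cochain.eq_zero_of_harmonic hskel hgap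
    (φ - X.coboundary m ψ)
    (by rw [map_sub, X.coboundary_coboundary, LinearMap.mem_ker.mp hφ, sub_zero]) hψ
  exact ⟨ψ, (sub_eq_zero.mp h0).symm⟩
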